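/- Let $k\ge 6$ and $g=2d\ge 6$ be integers, and let $G$ be a $(k,g)$-graph of excess $4$, that is, a finite simple $k$-regular graph whose girth (length of a shortest cycle) is exactly $g$ and whose number of vertices is $$n=2\left(1+(k-1)+(k-1)^2+\dots+(k-1)^{d-1}\right)+4 .$$ Let $A$ be the adjacency matrix of $G$, let $I$ and $J$ be the $n\times n$ identity and all-ones matrices, and let $E$ be the excess matrix of $G$, i.e. the $n\times n$ matrix whose $(u,v)$ entry is $1$ if $u$ and $v$ are at distance $d+1$ in $G$ and $0$ otherwise. Let $H_i(x)$ be the Dickson polynomials of the second kind with parameter $k-1$, given by $H_0(x)=1$, $H_1(x)=x$ and $H_{i+1}(x)=xH_i(x)-(k-1)H_{i-1}(x)$ for $i\ge 1$. Then $$kJ=(A+kI)\left(H_{d-1}(A)+E\right).$$ -/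

import Mathlib

/-- A finite simple graph is a `(k, g)`-graph if it is `k`-regular and its girth (the length of a
shortest cycle) is exactly `g`. -/
def SimpleGraph.IsKGGraph {V : Type*} [Fintype V] (G : SimpleGraph V) [DecidableRel G.Adj]
    (k g : ℕ) : Prop :=
  G.IsRegularOfDegree k ∧ G.egirth = (g : ℕ∞)

/-- The Moore bound `M(k, g)`:
`1 + k + k(k-1) + ... + k(k-1)^((g-3)/2)` for odd `g`, and
`2(1 + (k-1) + ... + (k-1)^((g-2)/2))` for even `g`. -/
def mooreBound (k g : ℕ) : ℤ :=
  if Odd g then 1 + ∑ i ∈ Finset.range ((g - 1) / 2), (k : ℤ) * ((k : ℤ) - 1) ^ i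
  else 2 * ∑ i ∈ Finset.range (g / 2), ((k : ℤ) - 1) ^ i

/-- `G` is a `(k, g)`-graph of excess `e`, the excess being the difference between the order of the
graph and the Moore bound. -/
def SimpleGraph.IsKGGraphOfExcess {V : Type*} [Fintype V] (G : SimpleGraph V)
    [DecidableRel G.Adj] (k g : ℕ) (e : ℤ) : Prop :=
  G.IsKGGraph k g ∧ (Fintype.card V : ℤ) - mooreBound k g = e

open Classical in
/-- The `i`-distance matrix `A_i` of a graph: the entry at `(u, v)` is `1` if `u` and `v` are at
distance `i`, and `0` otherwise. -/
noncomputable def SimpleGraph.distanceMatrix {V : Type*} (G : SimpleGraph V) (i : ℕ) :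
    Matrix V V ℝ :=
  Matrix.of fun u v => if G.edist u v = (i : ℕ∞) then 1 else 0

/-- The all-ones matrix `J`. -/
def allOnesMatrix (V : Type*) : Matrix V V ℝ :=
  Matrix.of fun _ _ => 1

/-! The point is that `G` is bipartite of diameter at most d + 1. Given this, H_{d-1}(A) + E has
entry 1 at (v, u) exactly when the distance has the parity of d + 1: `aeval_dickson_apply` supplies
the distances up to d - 1, and E supplies d + 1. All neighbours of v have the parity opposite to v,
so of A and kI one contributes k to the product and the other 0.

For bipartiteness, fix u and let H be the graph induced on the vertices at distance at least d from
u (`outerGraph`). For each neighbour v of u, exactly four vertices are far from both u and v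
(`card_farSet`), and these cover all edges of H. The degree of s in H is the number of v whose four
vertices include s, so the degrees sum to 4k, and to at least k over the ends of any edge. H has no
triangle or quadrangle, so for k ≥ 6 its edges form two stars with nonadjacent centres of degree k
(`degree_eq_iff_of_adj_of_cover`). Degree k in H means distance other than d from u, so each edge of
H joins level d to a later level. Hence parity changes along every edge, and level d + 2 is empty.
-/

namespace SimpleGraph

/-! ### Short cycles from distance coincidences. -/

section Girth

variable {V : Type*} {G : SimpleGraph V}

/-- Two distinct paths with the same ends close up to a cycle no longer than their total length. -/
theorem egirth_le_of_isPath_of_ne {u v : V} {p q : G.Walk u v} (hp : p.IsPath) (hq : q.IsPath)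
    (hne : p ≠ q) : G.egirth ≤ ((p.length + q.length : ℕ) : ℕ∞) := by
  classical
  let H : SimpleGraph V := fromEdgeSet {e | e ∈ p.edges ∨ e ∈ q.edges}
  have hpH : ∀ e ∈ p.edges, e ∈ H.edgeSet := fun e he => by
    rw [edgeSet_fromEdgeSet]
    exact ⟨Or.inl he, G.not_isDiag_of_mem_edgeSet (p.edges_subset_edgeSet he)⟩
  have hqH : ∀ e ∈ q.edges, e ∈ H.edgeSet := fun e he => by
    rw [edgeSet_fromEdgeSet]
    exact ⟨Or.inr he, G.not_isDiag_of_mem_edgeSet (q.edges_subset_edgeSet he)⟩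
  -- In an acyclic graph the ends determine the path, so the union of the two paths contains a
  -- cycle.
  have hcyc : ¬ H.IsAcyclic := fun h => by
    have heq := congrArg (fun r : H.Path u v => r.1.support)
      ((h.subsingleton_path u v).elim ⟨p.transfer H hpH, hp.transfer hpH⟩
        ⟨q.transfer H hqH, hq.transfer hqH⟩)
    simp only [Walk.support_transfer] at heq
    exact hne (Walk.ext_support heq)
  obtain ⟨a, c, hc, -⟩ := exists_egirth_eq_length.mpr hcyc
  have hsub : ∀ e ∈ c.edges, e ∈ p.edges ∨ e ∈ q.edges := fun e he => by
    have := c.edges_subset_edgeSet he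
    rw [edgeSet_fromEdgeSet] at this
    exact this.1
  have hcG : ∀ e ∈ c.edges, e ∈ G.edgeSet := fun e he =>
    (hsub e he).elim (fun h => p.edges_subset_edgeSet h) (fun h => q.edges_subset_edgeSet h)
  have hlen : c.length ≤ p.length + q.length := by
    rw [← c.length_edges, ← p.length_edges, ← q.length_edges, ← List.length_append]
    refine (List.subperm_of_subset hc.edges_nodup fun e he => ?_).length_le
    exact List.mem_append.mpr (hsub e he)
  calc G.egirth ≤ ((c.transfer G hcG).length : ℕ∞) := egirth_le_length (hc.transfer hcG)
    _ ≤ _ := by rw [Walk.length_transfer]; exact_mod_cast hlen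

theorem exists_isPath_of_edist_eq {u v : V} {i : ℕ} (h : G.edist v u = i) :
    ∃ p : G.Walk v u, p.IsPath ∧ p.length = i := by
  obtain ⟨p, hp⟩ := exists_walk_of_edist_eq_coe h
  refine ⟨p, p.isPath_of_length_eq_dist ?_, hp⟩
  rw [hp, dist, h, ENat.toNat_natCast]

theorem exists_isPath_cons_of_edist_le {u v w : V} {i : ℕ} (hvw : G.Adj v w)
    (h : G.edist w u = i) (hv : (i : ℕ∞) ≤ G.edist v u) :
    ∃ p : G.Walk w u, (Walk.cons hvw p).IsPath ∧ p.length = i := by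
  classical
  obtain ⟨p, hp, hpi⟩ := exists_isPath_of_edist_eq h
  refine ⟨p, (Walk.cons_isPath_iff _ _).mpr ⟨hp, fun hmem => ?_⟩, hpi⟩
  have hsplit := congrArg Walk.length (p.take_spec hmem)
  rw [Walk.length_append] at hsplit
  -- If v lay on the path, the part after v would already have length i, forcing w = v.
  have h1 : (i : ℕ∞) ≤ (p.dropUntil v hmem).length := hv.trans (edist_le _)
  have h2 : i ≤ (p.dropUntil v hmem).length := by exact_mod_cast h1
  have h3 : (p.takeUntil v hmem).length = 0 := by omega
  exact hvw.ne (Walk.eq_of_length_eq_zero h3).symm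

theorem egirth_le_of_two_parents {u v w w' : V} {i : ℕ} (hw : G.Adj v w) (hw' : G.Adj v w')
    (hne : w ≠ w') (h : G.edist w u = i) (h' : G.edist w' u = i)
    (hv : (i : ℕ∞) ≤ G.edist v u) : G.egirth ≤ ((2 * (i + 1) : ℕ) : ℕ∞) := by
  obtain ⟨p, hp, hpi⟩ := exists_isPath_cons_of_edist_le hw h hv
  obtain ⟨q, hq, hqi⟩ := exists_isPath_cons_of_edist_le hw' h' hv
  have := egirth_le_of_isPath_of_ne hp hq (by rintro ⟨⟩; exact hne rfl)
  rw [Walk.length_cons, Walk.length_cons, hpi, hqi] at this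
  rwa [two_mul]

theorem egirth_le_of_adj_of_edist_eq {u v w : V} {i : ℕ} (hw : G.Adj v w)
    (h : G.edist v u = i) (h' : G.edist w u = i) : G.egirth ≤ ((2 * i + 1 : ℕ) : ℕ∞) := by
  obtain ⟨p, hp, hpi⟩ := exists_isPath_cons_of_edist_le hw h' h.ge
  obtain ⟨q, hq, hqi⟩ := exists_isPath_of_edist_eq h
  have := egirth_le_of_isPath_of_ne hp hq (by
    rintro rfl
    rw [Walk.length_cons] at hqi
    omega)
  rw [Walk.length_cons, hpi, hqi] at this
  convert this using 2
  ring

end Girth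

/-! ### Natural-valued distances and the local tree structure. -/

section TruncatedDistance

variable {V : Type*}

/-- The distance from `v` to `u`, truncated at `N`. -/
noncomputable def truncDist (G : SimpleGraph V) (N : ℕ) (u v : V) : ℕ :=
  (min (G.edist u v) N).toNat

variable {G : SimpleGraph V} {N : ℕ}

theorem coe_truncDist (u v : V) : (G.truncDist N u v : ℕ∞) = min (G.edist u v) N :=
  ENat.natCast_toNat (ne_top_of_le_ne_top (ENat.natCast_ne_top N) (min_le_right _ _))

theorem truncDist_eq_iff {u v : V} {i : ℕ} (hi : i < N) :
    G.truncDist N u v = i ↔ G.edist u v = i := by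
  have hN : (i : ℕ∞) < N := by exact_mod_cast hi
  rw [← Nat.cast_inj (R := ℕ∞), coe_truncDist]
  constructor
  · intro h
    rcases min_choice (G.edist u v) N with h' | h'
    · rw [← h', h]
    · rw [h'] at h
      exact absurd h hN.ne'
  · intro h
    rw [h, min_eq_left hN.le]

theorem truncDist_comm (u v : V) : G.truncDist N u v = G.truncDist N v u := by
  rw [truncDist, truncDist, edist_comm]

theorem truncDist_le_add_one {u v w : V} (h : G.Adj v w) :
    G.truncDist N u v ≤ G.truncDist N u w + 1 := by
  rw [← Nat.cast_le (α := ℕ∞), Nat.cast_add, coe_truncDist, coe_truncDist, Nat.cast_one,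
    ← min_add_add_right]
  refine le_min ((min_le_left _ _).trans ?_) ((min_le_right _ _).trans le_self_add)
  rw [← edist_eq_one_iff_adj.mpr h.symm]
  exact SimpleGraph.edist_triangle

theorem exists_adj_truncDist_add_one_eq {u v : V} (h0 : 0 < G.truncDist N u v)
    (hN : G.truncDist N u v < N) :
    ∃ w, G.Adj v w ∧ G.truncDist N u w + 1 = G.truncDist N u v := by
  obtain ⟨i, hi⟩ : ∃ i, G.truncDist N u v = i + 1 := ⟨_, (Nat.succ_pred_eq_of_pos h0).symm⟩
  rw [hi] at hN
  have he := (truncDist_eq_iff hN).mp hi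
  rw [edist_comm] at he
  obtain ⟨p, hp⟩ := exists_walk_of_edist_eq_coe he
  cases p with
  | nil => simp at hp
  | @cons _ w _ hvw q =>
    rw [Walk.length_cons, Nat.add_right_cancel_iff] at hp
    refine ⟨w, hvw, ?_⟩
    have h1 : G.truncDist N u w ≤ i := by
      rw [truncDist_comm, ← Nat.cast_le (α := ℕ∞), coe_truncDist, ← hp]
      exact (min_le_left _ _).trans (edist_le q)
    have := truncDist_le_add_one (N := N) (u := u) hvw
    omega

/-- A (truncated) distance function `δ` of a graph that looks like a tree up to distance `d`
around every vertex and every edge. -/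
structure IsTreeLike (G : SimpleGraph V) (d : ℕ) (δ : V → V → ℕ) : Prop where
  symm : ∀ u v, δ u v = δ v u
  eq_zero_iff : ∀ u v, δ u v = 0 ↔ u = v
  le_add_one : ∀ u v w, G.Adj v w → δ u v ≤ δ u w + 1
  exists_parent : ∀ u v, 0 < δ u v → δ u v ≤ d → ∃ w, G.Adj v w ∧ δ u w + 1 = δ u v
  ne_of_adj : ∀ u v w, G.Adj v w → δ u v < d → δ u v ≠ δ u w
  parent_unique : ∀ u v w w', δ u v < d → G.Adj v w → G.Adj v w' → δ u w + 1 = δ u v →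
    δ u w' + 1 = δ u v → w = w'

/-- An edge inside level i < d would give a cycle of length at most 2i + 1, and two parents of a
vertex of level i < d one of length at most 2i. Truncation at d + 2 keeps distances up to d + 1
exact and sends unreachable pairs to d + 2, so excluding that value also yields connectedness. -/
theorem isTreeLike_truncDist {d : ℕ} (hd : 0 < d) (hG : G.egirth = ((2 * d : ℕ) : ℕ∞)) :
    G.IsTreeLike d (G.truncDist (d + 2)) where
  symm := truncDist_comm
  eq_zero_iff u v := by
    rw [truncDist_eq_iff (by omega), Nat.cast_zero, edist_eq_zero_iff]
  le_add_one _ _ _ h := truncDist_le_add_one h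
  exists_parent u v h0 hd := exists_adj_truncDist_add_one_eq h0 (by omega)
  ne_of_adj u v w hvw hlt heq := by
    have h := (truncDist_eq_iff (i := G.truncDist (d + 2) u v) (by omega)).mp heq.symm
    have h' := (truncDist_eq_iff (i := G.truncDist (d + 2) u v) (by omega)).mp rfl
    rw [edist_comm] at h h'
    have := egirth_le_of_adj_of_edist_eq hvw h' h
    rw [hG, Nat.cast_le] at this
    omega
  parent_unique u v w w' hlt hw hw' h h' := by
    by_contra hne
    have hv := (truncDist_eq_iff (i := G.truncDist (d + 2) u v) (by omega)).mp rfl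
    have e := (truncDist_eq_iff (i := G.truncDist (d + 2) u w) (by omega)).mp rfl
    have e' := (truncDist_eq_iff (G := G) (N := d + 2) (u := u) (v := w')
      (i := G.truncDist (d + 2) u w) (by omega)).mp (by omega)
    rw [edist_comm] at e e' hv
    have := egirth_le_of_two_parents hw hw' hne e e' (by rw [hv]; exact_mod_cast (by omega))
    rw [hG, Nat.cast_le] at this
    omega

end TruncatedDistance

/-! ### Graphs without triangles and quadrangles that have a vertex cover of size four. -/

section SmallCover

variable {V : Type*} (H : SimpleGraph V) [DecidableRel H.Adj]

/-- The indicator function of adjacency. -/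
def adjInd (v u : V) : ℕ := if H.Adj v u then 1 else 0

variable {H}

theorem adjInd_triangle_le (h3 : ∀ a b c, H.Adj a b → H.Adj b c → ¬ H.Adj a c) (a b c : V) :
    H.adjInd a b + H.adjInd a c + H.adjInd b c ≤ 2 := by
  have := h3 a b c
  unfold adjInd
  split_ifs with h1 h2 h3 <;> first | omega | exact absurd h2 (this h1 h3)

theorem adjInd_quadrangle_le
    (h4 : ∀ a b c c', a ≠ b → H.Adj a c → H.Adj b c → H.Adj a c' → H.Adj b c' → c = c')
    {a b c c' : V} (hab : a ≠ b) (hcc' : c ≠ c') :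
    H.adjInd a c + H.adjInd b c + H.adjInd a c' + H.adjInd b c' ≤ 3 := by
  have := h4 a b c c' hab
  unfold adjInd
  split_ifs with h1 h2 h3 h4 <;> first | omega | exact absurd (this h1 h2 h3 h4) hcc'

theorem adjInd_comm (a b : V) : H.adjInd a b = H.adjInd b a := by
  simp only [adjInd, H.adj_comm a b]

theorem adjInd_self (a : V) : H.adjInd a a = 0 := if_neg (H.loopless.irrefl a)

/-- Four vertices of a graph without triangles and quadrangles span at most three edges. -/
theorem edges_on_four_le_three (h3 : ∀ a b c, H.Adj a b → H.Adj b c → ¬ H.Adj a c)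
    (h4 : ∀ a b c c', a ≠ b → H.Adj a c → H.Adj b c → H.Adj a c' → H.Adj b c' → c = c')
    {p q x y : V} (hpq : p ≠ q) (hpx : p ≠ x) (hpy : p ≠ y) (hqx : q ≠ x) (hqy : q ≠ y)
    (hxy : x ≠ y) :
    H.adjInd p q + H.adjInd p x + H.adjInd p y + H.adjInd q x +
      H.adjInd q y + H.adjInd x y ≤ 3 := by
  have t1 := adjInd_triangle_le h3 p q x
  have t2 := adjInd_triangle_le h3 p q y
  have t3 := adjInd_triangle_le h3 p x y
  have t4 := adjInd_triangle_le h3 q x y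
  have c1 := adjInd_quadrangle_le h4 hpq hxy
  have c2 := adjInd_quadrangle_le h4 hpx hqy
  have c3 := adjInd_quadrangle_le h4 hpy hqx
  rw [adjInd_comm x q] at c2
  rw [adjInd_comm y q, adjInd_comm y x] at c3
  omega

variable [Fintype V] [DecidableEq V]

-- Ordered adjacent pairs are sorted by which ends lie in `W`; crossing pairs occur equally often on
-- both sides.
variable (H) in
theorem two_mul_sum_degree_add (W : Finset V) :
    2 * ∑ v ∈ W, H.degree v + ∑ v ∈ Wᶜ, ∑ u ∈ Wᶜ, H.adjInd v u =
      ∑ v, H.degree v + ∑ v ∈ W, ∑ u ∈ W, H.adjInd v u := by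
  have hdeg : ∀ v, H.degree v = ∑ u ∈ W, H.adjInd v u + ∑ u ∈ Wᶜ, H.adjInd v u := by
    intro v
    rw [Finset.sum_add_sum_compl]
    simp [adjInd, ← card_neighborFinset_eq_degree, neighborFinset_eq_filter]
  have hswap : ∑ v ∈ Wᶜ, ∑ u ∈ W, H.adjInd v u = ∑ v ∈ W, ∑ u ∈ Wᶜ, H.adjInd v u := by
    rw [Finset.sum_comm]
    simp only [adjInd, H.adj_comm]
  rw [← Finset.sum_add_sum_compl W (fun v => H.degree v)]
  simp only [hdeg, Finset.sum_add_distrib]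
  rw [hswap]
  ring

theorem two_mul_sum_degree_le (W : Finset V) :
    2 * ∑ v ∈ W, H.degree v ≤ ∑ v, H.degree v + ∑ v ∈ W, ∑ u ∈ W, H.adjInd v u := by
  rw [← two_mul_sum_degree_add]
  exact Nat.le_add_right _ _

theorem two_mul_sum_degree_of_cover {W : Finset V} (hW : ∀ p q, H.Adj p q → p ∈ W ∨ q ∈ W) :
    2 * ∑ v ∈ W, H.degree v = ∑ v, H.degree v + ∑ v ∈ W, ∑ u ∈ W, H.adjInd v u := by
  rw [← two_mul_sum_degree_add, left_eq_add]
  refine Finset.sum_eq_zero fun v hv => Finset.sum_eq_zero fun u hu => ?_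
  rw [adjInd, if_neg]
  intro h
  rw [Finset.mem_compl] at hv hu
  exact (hW v u h).elim hv hu

variable {k : ℕ}

/-- An edge pq avoiding x and y would give {p, q, x, y} degree sum at least 3k - 2 and at most three
inner edges, so 2(3k - 2) ≤ 4k + 6 and k ≤ 5. -/
theorem mem_of_adj_of_two_large_degrees (hk : 6 ≤ k) (hsum : ∑ v, H.degree v = 4 * k)
    (hedge : ∀ p q, H.Adj p q → k ≤ H.degree p + H.degree q)
    (h3 : ∀ a b c, H.Adj a b → H.Adj b c → ¬ H.Adj a c)
    (h4 : ∀ a b c c', a ≠ b → H.Adj a c → H.Adj b c → H.Adj a c' → H.Adj b c' → c = c')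
    {x y : V} (hxy : x ≠ y) (hx : k ≤ H.degree x + 1) (hy : k ≤ H.degree y + 1) {p q : V}
    (hpq : H.Adj p q) : p ∈ ({x, y} : Finset V) ∨ q ∈ ({x, y} : Finset V) := by
  by_contra hcon
  simp only [Finset.mem_insert, Finset.mem_singleton, not_or] at hcon
  obtain ⟨⟨hpx, hpy⟩, hqx, hqy⟩ := hcon
  have h := two_mul_sum_degree_le (H := H) {p, q, x, y}
  have hle := edges_on_four_le_three h3 h4 hpq.ne hpx hpy hqx hqy hxy
  have hpq' := hedge p q hpq
  simp only [hsum, Finset.sum_insert, Finset.mem_insert, Finset.mem_singleton, hpq.ne, hpx, hpy,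
    hqx, hqy, hxy, or_self, not_false_eq_true, Finset.sum_singleton, adjInd_self,
    adjInd_comm q p, adjInd_comm x p, adjInd_comm x q, adjInd_comm y p, adjInd_comm y q,
    adjInd_comm y x] at h
  omega

/-- In a vertex cover of size four, a vertex of small degree has at most one neighbour outside. -/
theorem card_neighborFinset_sdiff_le_one (hk : 6 ≤ k)
    (hedge : ∀ p q, H.Adj p q → k ≤ H.degree p + H.degree q)
    (h3 : ∀ a b c, H.Adj a b → H.Adj b c → ¬ H.Adj a c)
    (h4 : ∀ a b c c', a ≠ b → H.Adj a c → H.Adj b c → H.Adj a c' → H.Adj b c' → c = c')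
    {X : Finset V} (hX : X.card = 4) (hcov : ∀ p q, H.Adj p q → p ∈ X ∨ q ∈ X) {y : V}
    (hyX : y ∈ X) (hy : H.degree y + 2 ≤ k) : (H.neighborFinset y \ X).card ≤ 1 := by
  by_contra hcard
  obtain ⟨p, hp, q, hq, hpq⟩ := Finset.one_lt_card.mp (not_le.mp hcard)
  simp only [Finset.mem_sdiff, mem_neighborFinset] at hp hq
  have hsub : ∀ r, r ∉ X → H.neighborFinset r ⊆ X := fun r hr s hs =>
    (hcov r s ((mem_neighborFinset _ _ _).mp hs)).resolve_left hr
  have hinter : (H.neighborFinset p ∩ H.neighborFinset q).card ≤ 1 := by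
    refine Finset.card_le_one.mpr fun a ha b hb => ?_
    simp only [Finset.mem_inter, mem_neighborFinset] at ha hb
    exact h4 p q a b hpq ha.1 ha.2 hb.1 hb.2
  -- Both neighbourhoods lie in X and share at most one vertex, so deg p + deg q ≤ 5; the bounds
  -- along yp and yq then force deg y ≥ k - 2 ≥ 4.
  have hunion := Finset.card_le_card (Finset.union_subset (hsub p hp.2) (hsub q hq.2))
  have hadd := Finset.card_union_add_card_inter (H.neighborFinset p) (H.neighborFinset q)
  simp only [card_neighborFinset_eq_degree] at hadd
  have h1 := hedge y p hp.1
  have h2 := hedge y q hq.1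
  -- Neighbours of y in X are kept, the others replaced by a second neighbour in X. Without
  -- triangles and quadrangles this is injective, so deg y ≤ 3.
  have hother : ∀ r ∈ H.neighborFinset y, ∃ s ∈ X.erase y,
      (s = r) ∨ (r ∉ X ∧ H.Adj r s) := by
    intro r hr
    rw [mem_neighborFinset] at hr
    by_cases hrX : r ∈ X
    · exact ⟨r, Finset.mem_erase.mpr ⟨hr.ne', hrX⟩, Or.inl rfl⟩
    · have h3 := hedge y r hr
      obtain ⟨s, hs, hsy⟩ := Finset.exists_mem_ne
        (s := H.neighborFinset r) (by rw [card_neighborFinset_eq_degree]; omega) y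
      exact ⟨s, Finset.mem_erase.mpr ⟨hsy, hsub r hrX hs⟩,
        Or.inr ⟨hrX, (mem_neighborFinset _ _ _).mp hs⟩⟩
  choose! f hf hf' using hother
  have hle : (H.neighborFinset y).card ≤ (X.erase y).card := by
    refine Finset.card_le_card_of_injOn f (fun r hr => hf r hr) fun r hr s hs hrs => ?_
    have hfy := Finset.ne_of_mem_erase (hf r hr)
    have hr' := hf' r hr
    have hs' := hf' s hs
    rw [← hrs] at hs'
    simp only [Finset.mem_coe, mem_neighborFinset] at hr hs
    rcases hr' with hr' | ⟨-, hr'⟩ <;> rcases hs' with hs' | ⟨-, hs'⟩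
    · exact hr'.symm.trans hs'
    · rw [hr'] at hs'
      exact absurd hr (h3 y s r hs hs')
    · rw [hs'] at hr'
      exact absurd hs (h3 y r s hr hr')
    · exact h4 y (f r) r s hfy.symm hr hr'.symm hs hs'.symm
  rw [card_neighborFinset_eq_degree, Finset.card_erase_of_mem hyX] at hle
  omega

/-- Otherwise all of X but a vertex x of maximal degree have at most one neighbour outside X. The
cover identity then leaves k ≤ 3 + e, with e ≤ 2 the number of edges among the other three vertices.
-/
theorem exists_two_large_degrees (hk : 6 ≤ k) (hsum : ∑ v, H.degree v = 4 * k)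
    (hle : ∀ v, H.degree v ≤ k)
    (hedge : ∀ p q, H.Adj p q → k ≤ H.degree p + H.degree q)
    (h3 : ∀ a b c, H.Adj a b → H.Adj b c → ¬ H.Adj a c)
    (h4 : ∀ a b c c', a ≠ b → H.Adj a c → H.Adj b c → H.Adj a c' → H.Adj b c' → c = c')
    {X : Finset V} (hX : X.card = 4) (hcov : ∀ p q, H.Adj p q → p ∈ X ∨ q ∈ X) :
    ∃ x y, x ≠ y ∧ k ≤ H.degree x + 1 ∧ k ≤ H.degree y + 1 := by
  obtain ⟨x, hxX, hmax⟩ := X.exists_max_image (fun v => H.degree v)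
    (Finset.card_pos.mp (by omega))
  by_contra hcon
  push Not at hcon
  have hlow : ∀ y ∈ X, y ≠ x → H.degree y + 2 ≤ k := by
    intro y hy hyx
    by_contra hlt
    have := hcon x y hyx.symm (by have := hmax y hy; omega)
    omega
  have hXe : (X.erase x).card = 3 := by rw [Finset.card_erase_of_mem hxX, hX]
  obtain ⟨a, b, c, hab, hac, hbc, habc⟩ := Finset.card_eq_three.mp hXe
  have hmem : ∀ y ∈ ({a, b, c} : Finset V), y ∈ X ∧ y ≠ x := fun y hy => by
    rw [← habc, Finset.mem_erase] at hy
    exact hy.symm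
  obtain ⟨haX, hax⟩ := hmem a (by simp)
  obtain ⟨hbX, hbx⟩ := hmem b (by simp)
  obtain ⟨hcX, hcx⟩ := hmem c (by simp)
  have hXeq : X = {x, a, b, c} := by rw [← habc, Finset.insert_erase hxX]
  have hout := fun y hy hyx =>
    card_neighborFinset_sdiff_le_one hk hedge h3 h4 hX hcov (y := y) hy (hlow y hy hyx)
  have hdeg : ∀ y, H.degree y = (H.neighborFinset y \ X).card + ∑ u ∈ X, H.adjInd y u := by
    intro y
    rw [← card_neighborFinset_eq_degree, ← Finset.card_sdiff_add_card_inter _ X]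
    congr 1
    rw [Finset.inter_comm]
    rw [← Finset.filter_mem_eq_inter, Finset.card_filter]
    simp only [mem_neighborFinset, adjInd]
  have hdx := hdeg x
  have hda := hdeg a
  have hdb := hdeg b
  have hdc := hdeg c
  have hoa := hout a haX hax
  have hob := hout b hbX hbx
  have hoc := hout c hcX hcx
  have h := two_mul_sum_degree_of_cover hcov
  have hx := hle x
  have htri := adjInd_triangle_le h3 a b c
  generalize (H.neighborFinset a \ X).card = oa at hda hoa
  generalize (H.neighborFinset b \ X).card = ob at hdb hob
  generalize (H.neighborFinset c \ X).card = oc at hdc hoc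
  simp only [hXeq, hsum, Finset.sum_insert, Finset.mem_insert, Finset.mem_singleton, hax.symm,
    hbx.symm, hcx.symm, hab, hac, hbc, or_self, not_false_eq_true, Finset.sum_singleton,
    adjInd_self, adjInd_comm a x, adjInd_comm b x, adjInd_comm b a, adjInd_comm c x,
    adjInd_comm c a, adjInd_comm c b] at h hda hdb hdc hdx
  omega

/-- In a graph of girth at least five with `2k` edges, maximum degree at most `k`, degree sum at
least `k` along every edge and a vertex cover of size four, every edge has exactly one end of
degree `k`. -/
theorem degree_eq_iff_of_adj_of_cover (hk : 6 ≤ k) (hsum : ∑ v, H.degree v = 4 * k)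
    (hle : ∀ v, H.degree v ≤ k)
    (hedge : ∀ p q, H.Adj p q → k ≤ H.degree p + H.degree q)
    (h3 : ∀ a b c, H.Adj a b → H.Adj b c → ¬ H.Adj a c)
    (h4 : ∀ a b c c', a ≠ b → H.Adj a c → H.Adj b c → H.Adj a c' → H.Adj b c' → c = c')
    {X : Finset V} (hX : X.card = 4) (hcov : ∀ p q, H.Adj p q → p ∈ X ∨ q ∈ X)
    {p q : V} (hpq : H.Adj p q) : H.degree p = k ↔ H.degree q ≠ k := by
  obtain ⟨x, y, hxy, hx, hy⟩ := exists_two_large_degrees hk hsum hle hedge h3 h4 hX hcov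
  have hcov' : ∀ p q, H.Adj p q → p ∈ ({x, y} : Finset V) ∨ q ∈ ({x, y} : Finset V) :=
    fun p q => mem_of_adj_of_two_large_degrees hk hsum hedge h3 h4 hxy hx hy
  have h := two_mul_sum_degree_of_cover hcov'
  have hx' := hle x
  have hy' := hle y
  rw [hsum, Finset.sum_pair hxy, Finset.sum_pair hxy, Finset.sum_pair hxy, Finset.sum_pair hxy]
    at h
  simp only [adjInd, H.loopless.irrefl, if_false, H.adj_comm y x] at h
  -- The cover identity reads 2(deg x + deg y) = 4k + 2[x ~ y]; adjacency would push the degree sum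
  -- beyond 2k.
  have hnadj : ¬ H.Adj x y := fun hadj => by
    rw [if_pos hadj] at h
    omega
  rw [if_neg hnadj] at h
  have hnew : ∀ r, r ∉ ({x, y} : Finset V) → H.degree r ≠ k := by
    intro r hr
    have : H.neighborFinset r ⊆ {x, y} := fun s hs =>
      (hcov' r s ((mem_neighborFinset _ _ _).mp hs)).resolve_left hr
    have := Finset.card_le_card this
    rw [Finset.card_pair hxy, card_neighborFinset_eq_degree] at this
    omega
  have hcen : ∀ r, r ∈ ({x, y} : Finset V) → H.degree r = k := by
    intro r hr
    rw [Finset.mem_insert, Finset.mem_singleton] at hr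
    rcases hr with rfl | rfl <;> omega
  have hiff : ∀ r, H.degree r = k ↔ r ∈ ({x, y} : Finset V) := fun r =>
    ⟨fun hr => by by_contra h; exact hnew r h hr, hcen r⟩
  have hone : ¬ (p ∈ ({x, y} : Finset V) ∧ q ∈ ({x, y} : Finset V)) := by
    simp only [Finset.mem_insert, Finset.mem_singleton]
    rintro ⟨rfl | rfl, rfl | rfl⟩
    · exact hpq.ne rfl
    · exact hnadj hpq
    · exact hnadj hpq.symm
    · exact hpq.ne rfl
  have := hcov' p q hpq
  rw [Ne, hiff, hiff]
  tauto

end SmallCover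

/-! ### Counting in tree-like distances, the graph far from a vertex, and parity. -/

namespace IsTreeLike

variable {V : Type*} {G : SimpleGraph V} {d k : ℕ} {δ : V → V → ℕ}

theorem eq_or_eq_of_adj (h : G.IsTreeLike d δ) {u v w : V} (hvw : G.Adj v w) (hd : δ u v < d) :
    δ u w = δ u v + 1 ∨ δ u w + 1 = δ u v := by
  have h1 := h.le_add_one u v w hvw
  have h2 := h.le_add_one u w v hvw.symm
  have h3 := h.ne_of_adj u v w hvw hd
  omega

theorem le_add_one_left (h : G.IsTreeLike d δ) {u v : V} (huv : G.Adj u v) (s : V) :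
    δ u s ≤ δ v s + 1 := by
  rw [h.symm u s, h.symm v s]
  exact h.le_add_one s u v huv

theorem not_adj_of_adj_of_adj (h : G.IsTreeLike d δ) (hd : 2 ≤ d) {a b c : V} (hab : G.Adj a b)
    (hbc : G.Adj b c) : ¬ G.Adj a c := by
  have h0 := (h.eq_zero_iff a a).mpr rfl
  have key : ∀ x, G.Adj a x → δ a x = 1 := fun x hx => by
    have h1 := h.le_add_one a x a hx.symm
    have h2 := (h.eq_zero_iff a x).not.mpr hx.ne
    omega
  intro hac
  have h1 := key b hab
  have h2 := key c hac
  exact h.ne_of_adj a b c hbc (by omega) (by omega)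

theorem eq_of_common_neighbors (h : G.IsTreeLike d δ) (hd : 3 ≤ d) {a b c c' : V} (hne : a ≠ b)
    (hac : G.Adj a c) (hbc : G.Adj b c) (hac' : G.Adj a c') (hbc' : G.Adj b c') : c = c' := by
  have h0 := (h.eq_zero_iff a a).mpr rfl
  have key : ∀ x, G.Adj a x → δ a x = 1 := fun x hx => by
    have h1 := h.le_add_one a x a hx.symm
    have h2 := (h.eq_zero_iff a x).not.mpr hx.ne
    omega
  have h1 := key c hac
  have h2 := key c' hac'
  have h3 := (h.eq_zero_iff a b).not.mpr hne
  have h4 := h.eq_or_eq_of_adj (u := a) hbc.symm (by omega)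
  have h5 : δ a b = 2 := by omega
  exact h.parent_unique a b c c' (by omega) hbc hbc' (by omega) (by omega)

/-- The subgraph spanned by the vertices at distance at least `d` from a given vertex. -/
def outerGraph (G : SimpleGraph V) (d : ℕ) (f : V → ℕ) : SimpleGraph V where
  Adj s t := G.Adj s t ∧ d ≤ f s ∧ d ≤ f t
  symm := ⟨fun _ _ hst => ⟨hst.1.symm, hst.2.2, hst.2.1⟩⟩
  loopless := ⟨fun _ hs => hs.1.ne rfl⟩

theorem outerGraph_adj {f : V → ℕ} {s t : V} :
    (outerGraph G d f).Adj s t ↔ G.Adj s t ∧ d ≤ f s ∧ d ≤ f t := Iff.rfl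

variable [Fintype V]

/-- The vertices that are far from both ends of an edge. -/
def farSet (d : ℕ) (δ : V → V → ℕ) (u v : V) : Finset V :=
  Finset.univ.filter fun s => d ≤ δ u s ∧ d ≤ δ v s

theorem mem_farSet {u v s : V} : s ∈ farSet d δ u v ↔ d ≤ δ u s ∧ d ≤ δ v s := by
  simp [farSet]

/-- If both ends missed the far set, they would be adjacent at equal distance d - 1 from v. -/
theorem mem_farSet_of_adj (h : G.IsTreeLike d δ) {u v p q : V} (huv : G.Adj u v)
    (hpq : (outerGraph G d (δ u)).Adj p q) : p ∈ farSet d δ u v ∨ q ∈ farSet d δ u v := by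
  obtain ⟨hpq, hp, hq⟩ := hpq
  rw [mem_farSet, mem_farSet]
  have h1 := h.le_add_one_left huv p
  have h2 := h.le_add_one_left huv q
  have h3 := h.ne_of_adj v p q hpq
  have h4 := h.ne_of_adj v q p hpq.symm
  omega

variable [DecidableRel G.Adj]

theorem card_parents (h : G.IsTreeLike d δ) {u v : V} (h0 : 0 < δ u v) (hd : δ u v < d) :
    ((G.neighborFinset v).filter fun w => δ u w + 1 = δ u v).card = 1 := by
  obtain ⟨w, hvw, hw⟩ := h.exists_parent u v h0 hd.le
  refine Finset.card_eq_one.mpr ⟨w, Finset.ext fun w' => ?_⟩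
  simp only [Finset.mem_filter, mem_neighborFinset, Finset.mem_singleton]
  constructor
  · rintro ⟨hvw', hw'⟩
    exact h.parent_unique u v w' w hd hvw' hvw hw' hw
  · rintro rfl
    exact ⟨hvw, hw⟩

theorem card_children (h : G.IsTreeLike d δ) (hk : G.IsRegularOfDegree k) {u v : V}
    (h0 : 0 < δ u v) (hd : δ u v < d) :
    ((G.neighborFinset v).filter fun w => δ u w = δ u v + 1).card = k - 1 := by
  have hsplit := Finset.card_filter_add_card_filter_not (s := G.neighborFinset v)
    (fun w => δ u w + 1 = δ u v)
  rw [h.card_parents h0 hd, card_neighborFinset_eq_degree, hk.degree_eq] at hsplit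
  rw [← hsplit, Nat.add_sub_cancel_left]
  congr 1
  refine Finset.filter_congr fun w hw => ?_
  have := h.eq_or_eq_of_adj ((mem_neighborFinset _ _ _).mp hw) hd
  omega

theorem card_branch (h : G.IsTreeLike d δ) (hk : G.IsRegularOfDegree k) {u v : V}
    (huv : G.Adj u v) (j : ℕ) (hj : j < d) :
    (Finset.univ.filter fun s => δ v s = j ∧ δ u s = j + 1).card = (k - 1) ^ j := by
  induction j with
  | zero =>
    rw [pow_zero, Finset.card_eq_one]
    refine ⟨v, Finset.ext fun s => ?_⟩
    simp only [Finset.mem_filter, Finset.mem_univ, true_and, Finset.mem_singleton,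
      h.eq_zero_iff v s]
    constructor
    · exact fun hs => hs.1.symm
    · intro hs
      rw [hs]
      have h1 := h.le_add_one u v u huv.symm
      have h2 := (h.eq_zero_iff u u).mpr rfl
      have h3 := (h.eq_zero_iff u v).not.mpr huv.ne
      exact ⟨rfl, by omega⟩
  | succ j ih =>
    have key := Finset.card_mul_eq_card_mul G.Adj
      (s := Finset.univ.filter fun s => δ v s = j ∧ δ u s = j + 1)
      (t := Finset.univ.filter fun s => δ v s = j + 1 ∧ δ u s = j + 1 + 1)
      (m := k - 1) (n := 1) ?_ ?_
    · rw [mul_one, ih (by omega)] at key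
      rw [← key, pow_succ]
    · intro t ht
      simp only [Finset.mem_filter, Finset.mem_univ, true_and] at ht
      rw [← h.card_children hk (u := u) (v := t) (by omega) (by omega)]
      congr 1
      ext w
      simp only [Finset.mem_bipartiteAbove, Finset.mem_filter, Finset.mem_univ, true_and,
        mem_neighborFinset]
      have h1 := h.le_add_one_left huv w
      constructor
      · rintro ⟨hw, htw⟩
        exact ⟨htw, by omega⟩
      · rintro ⟨htw, hw⟩
        have h2 := h.le_add_one v w t htw.symm
        exact ⟨⟨by omega, by omega⟩, htw⟩
    · intro s hs
      simp only [Finset.mem_filter, Finset.mem_univ, true_and] at hs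
      refine Eq.trans ?_ (h.card_parents (u := v) (v := s) (by omega) (by omega))
      congr 1
      ext w
      simp only [Finset.mem_bipartiteBelow, Finset.mem_filter, Finset.mem_univ, true_and,
        mem_neighborFinset]
      have h1 := h.le_add_one_left huv w
      constructor
      · rintro ⟨hw, hws⟩
        exact ⟨hws.symm, by omega⟩
      · rintro ⟨hsw, hw⟩
        have h2 := h.le_add_one u s w hsw
        exact ⟨⟨by omega, by omega⟩, hsw.symm⟩

/-- Matches the last and first steps of the shortest paths from u to s: w and v correspond when δ v
w = d - 2, and uniqueness of parents makes this a bijection. -/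
theorem card_inner_neighbors (h : G.IsTreeLike d δ) (hd : 2 ≤ d) {u s : V} (hs : d ≤ δ u s) :
    ((G.neighborFinset s).filter fun w => ¬ d ≤ δ u w).card =
      ((G.neighborFinset u).filter fun v => ¬ d ≤ δ v s).card := by
  have key := Finset.card_mul_eq_card_mul (fun w v => δ v w + 2 = d)
    (s := (G.neighborFinset s).filter fun w => ¬ d ≤ δ u w)
    (t := (G.neighborFinset u).filter fun v => ¬ d ≤ δ v s) (m := 1) (n := 1) ?_ ?_
  · simpa using key
  · intro w hw
    simp only [Finset.mem_filter, mem_neighborFinset] at hw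
    have h1 := h.le_add_one u s w hw.1
    have h2 := h.symm u w
    rw [← h.card_parents (u := w) (v := u) (by omega) (by omega)]
    congr 1
    ext v
    simp only [Finset.mem_bipartiteAbove, Finset.mem_filter, mem_neighborFinset]
    have h3 := h.symm v w
    have h4 := h.le_add_one v s w hw.1
    constructor
    · rintro ⟨⟨huv, hv⟩, hvw⟩
      exact ⟨huv, by omega⟩
    · rintro ⟨huv, hv⟩
      exact ⟨⟨huv, by omega⟩, by omega⟩
  · intro v hv
    simp only [Finset.mem_filter, mem_neighborFinset] at hv
    have h1 := h.le_add_one_left hv.1 s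
    rw [← h.card_parents (u := v) (v := s) (by omega) (by omega)]
    congr 1
    ext w
    simp only [Finset.mem_bipartiteBelow, Finset.mem_filter, mem_neighborFinset]
    have h2 := h.le_add_one_left hv.1 w
    constructor
    · rintro ⟨⟨hsw, hw⟩, hvw⟩
      exact ⟨hsw, by omega⟩
    · rintro ⟨hsw, hw⟩
      exact ⟨⟨hsw, by omega⟩, by omega⟩

instance (f : V → ℕ) : DecidableRel (outerGraph G d f).Adj := fun s t =>
  inferInstanceAs (Decidable (G.Adj s t ∧ d ≤ f s ∧ d ≤ f t))

theorem degree_outerGraph (f : V → ℕ) {s : V} (hs : d ≤ f s) :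
    (outerGraph G d f).degree s = ((G.neighborFinset s).filter fun w => d ≤ f w).card := by
  rw [← card_neighborFinset_eq_degree]
  congr 1
  ext w
  simp [outerGraph_adj, hs]

theorem card_near_half (h : G.IsTreeLike d δ) (hk : G.IsRegularOfDegree k) {u v : V}
    (huv : G.Adj u v) :
    (Finset.univ.filter fun s => δ v s < d ∧ δ u s = δ v s + 1).card =
      ∑ j ∈ Finset.range d, (k - 1) ^ j := by
  rw [Finset.card_eq_sum_card_fiberwise (f := δ v) (t := Finset.range d)
    fun s hs => by simpa using (Finset.mem_filter.mp hs).2.1]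
  refine Finset.sum_congr rfl fun j hj => ?_
  rw [Finset.mem_range] at hj
  rw [← h.card_branch hk huv j hj, Finset.filter_filter]
  congr 1
  refine Finset.filter_congr fun s _ => ?_
  omega

theorem degree_outerGraph_add (hk : G.IsRegularOfDegree k) (f : V → ℕ) {s : V} (hs : d ≤ f s) :
    (outerGraph G d f).degree s + ((G.neighborFinset s).filter fun w => ¬ d ≤ f w).card = k := by
  rw [degree_outerGraph f hs, Finset.card_filter_add_card_filter_not,
    card_neighborFinset_eq_degree, hk.degree_eq]

theorem degree_outerGraph_eq_iff (h : G.IsTreeLike d δ) (hd : 2 ≤ d)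
    (hk : G.IsRegularOfDegree k) {u s : V} (hs : d ≤ δ u s) :
    (outerGraph G d (δ u)).degree s = k ↔ δ u s ≠ d := by
  have hadd := degree_outerGraph_add hk (δ u) hs
  have hiff : (outerGraph G d (δ u)).degree s = k ↔
      ((G.neighborFinset s).filter fun w => ¬ d ≤ δ u w).card = 0 := by omega
  rw [hiff, Finset.card_eq_zero, Finset.filter_eq_empty_iff]
  constructor
  · intro hw hsd
    obtain ⟨w, hsw, hwd⟩ := h.exists_parent u s (by omega) hsd.le
    exact hw ((mem_neighborFinset _ _ _).mpr hsw) (by omega)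
  · intro hsd w hw
    have := h.le_add_one u s w ((mem_neighborFinset _ _ _).mp hw)
    omega

variable [DecidableEq V]

/-- The remaining vertices form two disjoint trees of depth d - 1, rooted at u and v, which account
for the Moore bound. -/
theorem card_farSet (h : G.IsTreeLike d δ) (hk : G.IsRegularOfDegree k) {e : ℕ}
    (hcard : Fintype.card V = 2 * ∑ j ∈ Finset.range d, (k - 1) ^ j + e) {u v : V}
    (huv : G.Adj u v) : (farSet d δ u v).card = e := by
  have hsplit := Finset.card_filter_add_card_filter_not (s := (Finset.univ : Finset V))
    (fun s => d ≤ δ u s ∧ d ≤ δ v s)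
  have hnear : (Finset.univ.filter fun s => ¬ (d ≤ δ u s ∧ d ≤ δ v s)) =
      (Finset.univ.filter fun s => δ v s < d ∧ δ u s = δ v s + 1) ∪
        (Finset.univ.filter fun s => δ u s < d ∧ δ v s = δ u s + 1) := by
    ext s
    simp only [Finset.mem_union, Finset.mem_filter, Finset.mem_univ, true_and]
    have h1 := h.ne_of_adj s u v huv
    have h2 := h.ne_of_adj s v u huv.symm
    have h3 := h.le_add_one s u v huv
    have h4 := h.le_add_one s v u huv.symm
    rw [h.symm u s, h.symm v s]
    omega
  have hdisj : Disjoint (Finset.univ.filter fun s => δ v s < d ∧ δ u s = δ v s + 1)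
      (Finset.univ.filter fun s => δ u s < d ∧ δ v s = δ u s + 1) :=
    Finset.disjoint_filter.mpr fun s _ h1 h2 => by omega
  rw [hnear, Finset.card_union_of_disjoint hdisj, h.card_near_half hk huv,
    h.card_near_half hk huv.symm, Finset.card_univ, hcard] at hsplit
  rw [farSet]
  omega

theorem degree_outerGraph_eq_card (h : G.IsTreeLike d δ) (hd : 2 ≤ d)
    (hk : G.IsRegularOfDegree k) (u s : V) :
    (outerGraph G d (δ u)).degree s =
      ((G.neighborFinset u).filter fun v => s ∈ farSet d δ u v).card := by
  simp only [mem_farSet]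
  by_cases hs : d ≤ δ u s
  · have h1 := degree_outerGraph_add hk (δ u) hs
    have h2 := Finset.card_filter_add_card_filter_not (s := G.neighborFinset u)
      (fun v => d ≤ δ v s)
    rw [h.card_inner_neighbors hd hs] at h1
    rw [card_neighborFinset_eq_degree, hk.degree_eq] at h2
    simp only [hs, true_and]
    omega
  · simp only [hs, false_and, Finset.filter_false, Finset.card_empty]
    rw [← card_neighborFinset_eq_degree, Finset.card_eq_zero]
    ext w
    simp [outerGraph_adj, hs]

theorem sum_degree_outerGraph (h : G.IsTreeLike d δ) (hd : 2 ≤ d) (hk : G.IsRegularOfDegree k)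
    {e : ℕ} (hcard : Fintype.card V = 2 * ∑ j ∈ Finset.range d, (k - 1) ^ j + e) (u : V) :
    ∑ s, (outerGraph G d (δ u)).degree s = e * k := by
  simp only [h.degree_outerGraph_eq_card hd hk u]
  have := Finset.sum_card_bipartiteAbove_eq_sum_card_bipartiteBelow
    (s := Finset.univ) (t := G.neighborFinset u) (fun s v => s ∈ farSet d δ u v)
  refine this.trans ?_
  rw [Finset.sum_congr rfl fun v hv => (?_ : _ = e), Finset.sum_const,
    card_neighborFinset_eq_degree, hk.degree_eq, smul_eq_mul, mul_comm]
  rw [← h.card_farSet hk hcard ((mem_neighborFinset _ _ _).mp hv)]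
  congr 1
  ext s
  simp

/-- Each of the k neighbours v of u is counted by p or by q, since the far set of uv covers pq. -/
theorem le_degree_add_degree_outerGraph (h : G.IsTreeLike d δ) (hd : 2 ≤ d)
    (hk : G.IsRegularOfDegree k) {u p q : V} (hpq : (outerGraph G d (δ u)).Adj p q) :
    k ≤ (outerGraph G d (δ u)).degree p + (outerGraph G d (δ u)).degree q := by
  rw [h.degree_outerGraph_eq_card hd hk, h.degree_outerGraph_eq_card hd hk]
  refine le_trans ?_ (Finset.card_union_le _ _)
  rw [← Finset.filter_or, Finset.filter_true_of_mem, card_neighborFinset_eq_degree, hk.degree_eq]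
  exact fun v hv => h.mem_farSet_of_adj ((mem_neighborFinset _ _ _).mp hv) hpq

theorem eq_iff_ne_of_adj (h : G.IsTreeLike d δ) (hd : 3 ≤ d) (hk : G.IsRegularOfDegree k)
    (hk6 : 6 ≤ k) (hcard : Fintype.card V = 2 * ∑ j ∈ Finset.range d, (k - 1) ^ j + 4)
    {u p q : V} (hpq : (outerGraph G d (δ u)).Adj p q) :
    δ u p ≠ d ↔ δ u q = d := by
  have hne : (G.neighborFinset u).Nonempty := by
    rw [← Finset.card_pos, card_neighborFinset_eq_degree, hk.degree_eq]
    omega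
  obtain ⟨v, hv⟩ := hne
  rw [mem_neighborFinset] at hv
  have hle : ∀ s, (outerGraph G d (δ u)).degree s ≤ k := fun s => by
    rw [h.degree_outerGraph_eq_card (by omega) hk, ← hk.degree_eq u,
      ← card_neighborFinset_eq_degree]
    exact Finset.card_filter_le _ _
  have key := degree_eq_iff_of_adj_of_cover hk6
    (h.sum_degree_outerGraph (by omega) hk hcard u) hle
    (fun p q hpq => h.le_degree_add_degree_outerGraph (by omega) hk hpq)
    (fun a b c hab hbc hac => h.not_adj_of_adj_of_adj (by omega) hab.1 hbc.1 hac.1)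
    (fun a b c c' hne h1 h2 h3 h4 => h.eq_of_common_neighbors hd hne h1.1 h2.1 h3.1 h4.1)
    (h.card_farSet hk hcard hv) (fun p q hpq => h.mem_farSet_of_adj hv hpq) hpq
  rw [Ne, h.degree_outerGraph_eq_iff (by omega) hk hpq.2.1,
    h.degree_outerGraph_eq_iff (by omega) hk hpq.2.2, not_not] at key
  exact key

/-- A vertex beyond level d + 1 has degree k in the outer graph, so its neighbours would lie at
level d, too close to u. -/
theorem le_succ (h : G.IsTreeLike d δ) (hd : 3 ≤ d) (hk : G.IsRegularOfDegree k)
    (hk6 : 6 ≤ k) (hcard : Fintype.card V = 2 * ∑ j ∈ Finset.range d, (k - 1) ^ j + 4)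
    (u s : V) : δ u s ≤ d + 1 := by
  by_contra hs
  have hdeg := (h.degree_outerGraph_eq_iff (by omega) hk (u := u) (s := s) (by omega)).mpr
    (by omega)
  have hne : ((outerGraph G d (δ u)).neighborFinset s).Nonempty := by
    rw [← Finset.card_pos, card_neighborFinset_eq_degree, hdeg]
    omega
  obtain ⟨t, ht⟩ := hne
  rw [mem_neighborFinset] at ht
  have h1 := (eq_iff_ne_of_adj h hd hk hk6 hcard ht).mp (by omega)
  have h2 := h.le_add_one u s t ht.1
  omega

theorem mod_two_ne_of_adj (h : G.IsTreeLike d δ) (hd : 3 ≤ d) (hk : G.IsRegularOfDegree k)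
    (hk6 : 6 ≤ k) (hcard : Fintype.card V = 2 * ∑ j ∈ Finset.range d, (k - 1) ^ j + 4)
    (u : V) {p q : V} (hpq : G.Adj p q) : (δ u p + δ u q) % 2 = 1 := by
  have h1 := h.le_add_one u p q hpq
  have h2 := h.le_add_one u q p hpq.symm
  by_cases hp : δ u p < d
  · have := h.ne_of_adj u p q hpq hp
    omega
  by_cases hq : δ u q < d
  · have := h.ne_of_adj u q p hpq.symm hq
    omega
  have := eq_iff_ne_of_adj h hd hk hk6 hcard (u := u) (p := p) (q := q)
    ⟨hpq, not_lt.mp hp, not_lt.mp hq⟩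
  omega

theorem aeval_dickson_apply (h : G.IsTreeLike d δ) (hk : G.IsRegularOfDegree k) (j : ℕ)
    (hj : j < d) (u v : V) :
    Polynomial.aeval (G.adjMatrix ℝ) (Polynomial.dickson 2 ((k : ℝ) - 1) j) v u =
      if δ u v ≤ j ∧ (δ u v + j) % 2 = 0 then 1 else 0 := by
  induction j using Nat.twoStepInduction generalizing v with
  | zero =>
    have h0 := h.eq_zero_iff u v
    rw [Polynomial.dickson_zero]
    -- `Polynomial.dickson` of kind m starts at 3 - m, which is H_0 = 1 for the second kind.
    have e1 : (3 - ((2 : ℕ) : Polynomial ℝ)) = 1 := by norm_num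
    rw [e1, map_one, Matrix.one_apply]
    refine if_congr ?_ rfl rfl
    rw [eq_comm, ← h0]
    omega
  | one =>
    rw [Polynomial.dickson_one, Polynomial.aeval_X, adjMatrix_apply]
    refine if_congr ?_ rfl rfl
    have h0 := (h.eq_zero_iff u u).mpr rfl
    constructor
    · intro hvu
      have h1 := (h.eq_zero_iff u v).not.mpr hvu.ne'
      have h2 := h.le_add_one u v u hvu
      omega
    · rintro ⟨h1, h2⟩
      obtain ⟨w, hvw, hw⟩ := h.exists_parent u v (by omega) (by omega)
      rwa [(h.eq_zero_iff u w).mp (by omega)]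
  | more j ih ih' =>
    rw [Polynomial.dickson_add_two, map_sub, map_mul, map_mul, Polynomial.aeval_X,
      Polynomial.aeval_C, Matrix.sub_apply, adjMatrix_mul_apply, ← Algebra.smul_def,
      Matrix.smul_apply, ih (by omega), Finset.sum_congr rfl fun w _ => ih' (by omega) w,
      Finset.sum_boole, smul_eq_mul]
    by_cases hpar : (δ u v + j) % 2 = 0
    -- Up to level j all k neighbours count and k - (k - 1) = 1; at level j + 2 only the unique
    -- parent does.
    · by_cases hle : δ u v ≤ j
      · rw [Finset.filter_true_of_mem, card_neighborFinset_eq_degree, hk.degree_eq,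
          if_pos ⟨hle, hpar⟩, if_pos (by omega)]
        · ring
        · intro w hw
          have := h.eq_or_eq_of_adj (u := u) ((mem_neighborFinset _ _ _).mp hw) (by omega)
          omega
      · rw [if_neg (by tauto)]
        by_cases heq : δ u v = j + 2
        · have hone := h.card_parents (u := u) (v := v) (by omega) (by omega)
          rw [if_pos (by omega), mul_zero, sub_zero]
          refine (congrArg Nat.cast (Eq.trans (congrArg Finset.card ?_) hone)).trans Nat.cast_one
          refine Finset.filter_congr fun w hw => ?_
          have := h.eq_or_eq_of_adj (u := u) ((mem_neighborFinset _ _ _).mp hw) (by omega)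
          omega
        · rw [Finset.filter_false_of_mem, if_neg (by omega), Finset.card_empty]
          · simp
          · intro w hw
            have := h.le_add_one u v w ((mem_neighborFinset _ _ _).mp hw)
            omega
    · rw [Finset.filter_false_of_mem, if_neg (by tauto), if_neg (by omega), Finset.card_empty]
      · simp
      · intro w hw
        have h1 := h.le_add_one u v w ((mem_neighborFinset _ _ _).mp hw)
        have h2 := h.eq_or_eq_of_adj (u := u) ((mem_neighborFinset _ _ _).mp hw)
        omega

end IsTreeLike

end SimpleGraph

/-! ### The matrix identity. -/

theorem mainTheorem1 {V : Type*} [Fintype V] [DecidableEq V] (G : SimpleGraph V)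
    [DecidableRel G.Adj] (k g d : ℕ) (hk : 6 ≤ k) (hg : 6 ≤ g) (hgd : g = 2 * d)
    (hG : G.IsKGGraphOfExcess k g 4) :
    (k : ℝ) • allOnesMatrix V =
      (G.adjMatrix ℝ + (k : ℝ) • (1 : Matrix V V ℝ)) *
        (Polynomial.aeval (G.adjMatrix ℝ) (Polynomial.dickson 2 ((k : ℝ) - 1) (d - 1)) +
          G.distanceMatrix (d + 1)) := by
  obtain ⟨⟨hreg, hgirth⟩, hcard⟩ := hG
  subst hgd
  have hd : 3 ≤ d := by omega
  have hcard' : Fintype.card V = 2 * ∑ j ∈ Finset.range d, (k - 1) ^ j + 4 := by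
    rw [mooreBound, if_neg (by simp), Nat.mul_div_cancel_left _ two_pos] at hcard
    have hcast : ((k - 1 : ℕ) : ℤ) = (k : ℤ) - 1 := by
      rw [Nat.cast_sub (by omega), Nat.cast_one]
    rw [← hcast] at hcard
    zify
    linarith
  have h := SimpleGraph.isTreeLike_truncDist (by omega) hgirth
  have hM : ∀ v u, (Polynomial.aeval (G.adjMatrix ℝ)
      (Polynomial.dickson 2 ((k : ℝ) - 1) (d - 1)) + G.distanceMatrix (d + 1)) v u =
        if (G.truncDist (d + 2) u v + (d + 1)) % 2 = 0 then 1 else 0 := by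
    intro v u
    have hle := SimpleGraph.IsTreeLike.le_succ h hd hreg hk hcard' u v
    have hiff := SimpleGraph.truncDist_eq_iff (G := G) (N := d + 2) (u := v) (v := u)
      (i := d + 1) (by omega)
    rw [SimpleGraph.truncDist_comm] at hiff
    rw [Matrix.add_apply, h.aeval_dickson_apply hreg (d - 1) (by omega),
      SimpleGraph.distanceMatrix, Matrix.of_apply]
    simp only [← hiff]
    split_ifs <;> first | omega | norm_num
  ext v u
  rw [add_mul, smul_mul_assoc, one_mul, Matrix.add_apply, Matrix.smul_apply, Matrix.smul_apply,
    SimpleGraph.adjMatrix_mul_apply, hM, Finset.sum_congr rfl fun w _ => hM w u,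
    Finset.sum_boole, allOnesMatrix, Matrix.of_apply, smul_eq_mul, smul_eq_mul, mul_one]
  have hpar := fun w (hw : w ∈ G.neighborFinset v) =>
    SimpleGraph.IsTreeLike.mod_two_ne_of_adj h hd hreg hk hcard' u
      ((SimpleGraph.mem_neighborFinset _ _ _).mp hw)
  -- Either v has the parity of d + 1 and only kI contributes, or all k neighbours have it and only
  -- A does.
  by_cases hv : (G.truncDist (d + 2) u v + (d + 1)) % 2 = 0
  · rw [if_pos hv, Finset.filter_false_of_mem]
    · simp
    · intro w hw
      have := hpar w hw
      omega
  · rw [if_neg hv, Finset.filter_true_of_mem, SimpleGraph.card_neighborFinset_eq_degree,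
      hreg.degree_eq]
    · simp
    · intro w hw
      have := hpar w hw
      omega
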